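/- Let $$\sigma_X=\begin{pmatrix}0&1\\1&0\end{pmatrix},\qquad \sigma_Y=\begin{pmatrix}0&-i\\i&0\end{pmatrix},\qquad \sigma_Z=\begin{pmatrix}1&0\\0&-1\end{pmatrix}$$ be the Pauli matrices, let $\otimes$ denote the Kronecker product of matrices, and put $\sigma_{XX}=\sigma_X\otimes\sigma_X$, $\sigma_{YY}=\sigma_Y\otimes\sigma_Y$, $\sigma_{ZZ}=\sigma_Z\otimes\sigma_Z$, which are $4\times 4$ complex matrices. Then for every unitary matrix $X\in U(4)$ there exist $A_1,A_0,B_1,B_0\in SU(2)$ and $(k_0,k_x,k_y,k_z)\in\mathbb{R}^4$ such that $$X=(A_1\otimes A_0)\,\exp\!\bigl(i(k_0 I_4+k_x\sigma_{XX}+k_y\sigma_{YY}+k_z\sigma_{ZZ})\bigr)\,(B_1\otimes B_0),$$ where $I_4$ is the $4\times4$ identity matrix and $\exp$ is the matrix exponential. -/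

import Mathlib

open scoped Kronecker

noncomputable section

namespace KAK

/-- The Pauli matrix `σ_X`. -/
def sigmaX : Matrix (Fin 2) (Fin 2) ℂ := !![0, 1; 1, 0]

/-- The Pauli matrix `σ_Y`. -/
def sigmaY : Matrix (Fin 2) (Fin 2) ℂ := !![0, -Complex.I; Complex.I, 0]

/-- The Pauli matrix `σ_Z`. -/
def sigmaZ : Matrix (Fin 2) (Fin 2) ℂ := !![1, 0; 0, -1]

/-- The tensor (Kronecker) product of two `2 × 2` matrices as a `4 × 4` matrix, in the usual
lexicographic order: rows and columns `(i, j)` get the index `2 * i + j`. -/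
def tensor (A B : Matrix (Fin 2) (Fin 2) ℂ) : Matrix (Fin 4) (Fin 4) ℂ :=
  Matrix.reindex (finProdFinEquiv (m := 2) (n := 2)) (finProdFinEquiv (m := 2) (n := 2)) (A ⊗ₖ B)

/-- `σ_XX = σ_X ⊗ σ_X`. -/
def sigmaXX : Matrix (Fin 4) (Fin 4) ℂ := tensor sigmaX sigmaX

/-- `σ_YY = σ_Y ⊗ σ_Y`. -/
def sigmaYY : Matrix (Fin 4) (Fin 4) ℂ := tensor sigmaY sigmaY

/-- `σ_ZZ = σ_Z ⊗ σ_Z`. -/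
def sigmaZZ : Matrix (Fin 4) (Fin 4) ℂ := tensor sigmaZ sigmaZ

end KAK

end

/-! In the magic basis, whose vectors are common eigenvectors of the three commuting interaction
terms, real orthogonal matrices are products of local gates, up to signs. So the theorem reduces to
writing a unitary `U` as `O₁ D O₂ᵀ` with `O₁`, `O₂` real orthogonal and `D` diagonal unitary. For
that, `UᵀU` is symmetric and unitary. A Cayley transform turns it into a real symmetric matrix,
which the real spectral theorem diagonalizes; a square root of the diagonal part is `D`, and `O₁ = U
O₂ D⁻¹` is unitary and complex orthogonal, hence real
(`exists_orthogonal_mul_diagonal_mul_orthogonal`). Locality comes from quaternions: reflections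
generate the isometries of ℝ⁴ and each is `x ↦ -u x̄ u`, so every isometry is `x ↦ a x b` or `x ↦ a
x̄ b` (`exists_quat_isometry`). Conjugation is diagonal with entries ±1, so it is absorbed into `D`
and no determinant condition on `O₁`, `O₂` is needed. -/

namespace KAK

open Matrix

/-! ### Orthogonal-diagonal-orthogonal decomposition of unitary matrices -/

section Diagonalization

variable {n : Type*} [Fintype n] [DecidableEq n]

/-- Entrywise inclusion of real matrices into complex matrices. -/
def complexify : Matrix n n ℝ →+* Matrix n n ℂ := Complex.ofRealHom.mapMatrix

theorem complexify_apply (O : Matrix n n ℝ) (i j : n) : complexify O i j = (O i j : ℂ) := rfl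

theorem complexify_transpose (O : Matrix n n ℝ) : complexify Oᵀ = (complexify O)ᵀ := rfl

theorem conjTranspose_complexify (O : Matrix n n ℝ) : (complexify O)ᴴ = (complexify O)ᵀ := by
  ext i j; simp [complexify_apply]

theorem complexify_diagonal (d : n → ℝ) :
    complexify (diagonal d) = diagonal fun i => (d i : ℂ) := by
  ext i j
  by_cases h : i = j
  · subst h; simp [complexify_apply]
  · simp [complexify_apply, h]

theorem complexify_transpose_mul_self {O : Matrix n n ℝ} (hO : O ∈ orthogonalGroup n ℝ) :
    (complexify O)ᵀ * complexify O = 1 := by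
  rw [← complexify_transpose, ← map_mul, (mem_orthogonalGroup_iff' n ℝ).1 hO, map_one]

theorem complexify_mul_transpose_self {O : Matrix n n ℝ} (hO : O ∈ orthogonalGroup n ℝ) :
    complexify O * (complexify O)ᵀ = 1 := by
  rw [← complexify_transpose, ← map_mul, (mem_orthogonalGroup_iff n ℝ).1 hO, map_one]

theorem exists_complexify_eq_of_isHermitian_of_isSymm {H : Matrix n n ℂ} (hH : H.IsHermitian)
    (hs : H.IsSymm) : ∃ S : Matrix n n ℝ, S.IsHermitian ∧ complexify S = H := by
  have hre : complexify (H.map Complex.re) = H := by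
    ext i j
    rw [complexify_apply, map_apply]
    refine Complex.conj_eq_iff_re.1 ?_
    have h1 := hH.apply i j
    rw [hs.apply i j] at h1
    exact h1
  refine ⟨H.map Complex.re, ?_, hre⟩
  ext i j
  simp [hs.apply i j]

/-- A unitary matrix that is also complex orthogonal is real. -/
theorem exists_orthogonal_of_unitary {V : Matrix n n ℂ} (hu : Vᴴ * V = 1) (ht : Vᵀ * V = 1) :
    ∃ O ∈ orthogonalGroup n ℝ, complexify O = V := by
  have h : Vᴴ = Vᵀ := by
    have h2 := mul_eq_one_comm.1 ht
    calc Vᴴ = Vᴴ * (V * Vᵀ) := by rw [h2, mul_one]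
      _ = Vᵀ := by rw [← mul_assoc, hu, one_mul]
  have hre : complexify (V.map Complex.re) = V := by
    ext i j
    rw [complexify_apply, map_apply]
    refine Complex.conj_eq_iff_re.1 ?_
    exact congrFun (congrFun h j) i
  refine ⟨V.map Complex.re, ?_, hre⟩
  rw [mem_orthogonalGroup_iff']
  have h3 : complexify ((V.map Complex.re)ᵀ * V.map Complex.re) = complexify 1 := by
    rw [map_mul, complexify_transpose, hre, map_one, ht]
  exact Matrix.map_injective Complex.ofReal_injective h3

/-- The unit circle is infinite and `-P` has finitely many eigenvalues. Such a `c` makes the Cayley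
transform of `P` well defined. -/
theorem exists_norm_eq_one_isUnit_smul_one_add (P : Matrix n n ℂ) :
    ∃ c : ℂ, ‖c‖ = 1 ∧ IsUnit (c • (1 : Matrix n n ℂ) + P) := by
  have hinf : (Metric.sphere (0 : ℂ) 1).Infinite := by
    have : Set.InjOn (fun t : ℝ => Complex.exp (t * Complex.I)) (Set.Icc 0 1) := by
      intro s hs t ht h
      have := Complex.exp_inj_of_neg_pi_lt_of_le_pi (x := s * Complex.I) (y := t * Complex.I)
        (by simp; linarith [hs.1, Real.pi_gt_three]) (by simp; linarith [hs.2, Real.pi_gt_three])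
        (by simp; linarith [ht.1, Real.pi_gt_three]) (by simp; linarith [ht.2, Real.pi_gt_three]) h
      simpa using this
    refine ((Set.Icc_infinite zero_lt_one).image this).mono ?_
    rintro _ ⟨t, -, rfl⟩
    simp [Complex.norm_exp_ofReal_mul_I]
  obtain ⟨c, hc, hroot⟩ := hinf.exists_notMem_finset (-P).charpoly.roots.toFinset
  refine ⟨c, by simpa using hc, ?_⟩
  rw [Multiset.mem_toFinset, Polynomial.mem_roots (charpoly_monic _).ne_zero, Polynomial.IsRoot,
    eval_charpoly] at hroot
  rw [isUnit_iff_isUnit_det, isUnit_iff_ne_zero, smul_one_eq_diagonal]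
  simpa [Matrix.scalar_apply] using hroot

/-- A symmetric unitary matrix is diagonalized by a real orthogonal matrix. -/
theorem exists_orthogonal_diagonalization {P : Matrix n n ℂ} (hP : Pᴴ * P = 1) (hs : P.IsSymm) :
    ∃ O ∈ orthogonalGroup n ℝ, ∃ e : n → ℂ,
      P = complexify O * diagonal e * (complexify O)ᵀ := by
  obtain ⟨c, hc, hu⟩ := exists_norm_eq_one_isUnit_smul_one_add P
  have hcc : star c * c = 1 := by
    have := Complex.conj_mul' c
    simpa [hc] using this
  have hcc' : c * star c = 1 := by rw [mul_comm, hcc]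
  set N := c • (1 : Matrix n n ℂ) + P with hN
  set M := c • (1 : Matrix n n ℂ) - P with hM
  have hdet := (isUnit_iff_isUnit_det N).1 hu
  have hcomm : M * N = N * M := by
    simp only [hN, hM, mul_add, add_mul, mul_sub, sub_mul, smul_mul_assoc, mul_smul_comm, one_mul,
      mul_one, smul_add, smul_sub]
    abel
  have hcomm' : M * N⁻¹ = N⁻¹ * M := by
    have h1 : N⁻¹ * (M * N) * N⁻¹ = N⁻¹ * (N * M) * N⁻¹ := by rw [hcomm]
    rwa [← mul_assoc, nonsing_inv_mul_cancel_left _ _ hdet, mul_nonsing_inv_cancel_right _ _ hdet,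
      eq_comm] at h1
  have hNs : Nᵀ = N := by simp [hN, hs.eq]
  have hMs : Mᵀ = M := by simp [hM, hs.eq]
  -- Unitarity of `P` and `‖c‖ = 1` enter here: this makes `M * N⁻¹` skew-Hermitian.
  have hstar : Mᴴ * N = -(Nᴴ * M) := by
    simp only [hN, hM, conjTranspose_add, conjTranspose_sub, conjTranspose_smul, conjTranspose_one,
      mul_add, add_mul, mul_sub, sub_mul, smul_mul_assoc, mul_smul_comm, one_mul, mul_one, hP,
      smul_add, smul_sub, smul_smul, hcc', one_smul]
    abel
  -- Cayley transform of `P`: Hermitian and symmetric, hence real.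
  set H := Complex.I • (M * N⁻¹) with hH
  have hNH : IsUnit (Nᴴ).det := by rw [det_conjTranspose]; exact hdet.star
  have hherm : H.IsHermitian := by
    have h1 : N⁻¹ᴴ * Mᴴ = -(M * N⁻¹) := by
      rw [conjTranspose_nonsing_inv]
      calc (Nᴴ)⁻¹ * Mᴴ = (Nᴴ)⁻¹ * (Mᴴ * N) * N⁻¹ := by
            rw [mul_assoc, mul_nonsing_inv_cancel_right _ _ hdet]
        _ = -(M * N⁻¹) := by
            rw [hstar, mul_neg, nonsing_inv_mul_cancel_left _ _ hNH, neg_mul]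
    rw [IsHermitian, hH, conjTranspose_smul, conjTranspose_mul, h1]
    simp
  have hsymm : H.IsSymm := by
    rw [IsSymm, hH, transpose_smul, transpose_mul, transpose_nonsing_inv, hNs, hMs, hcomm']
  have hHN : H * N = Complex.I • M := by
    rw [hH, smul_mul_assoc, nonsing_inv_mul_cancel_right _ _ hdet]
  clear_value H
  obtain ⟨S, hS, hSH⟩ := exists_complexify_eq_of_isHermitian_of_isSymm hherm hsymm
  set O : Matrix n n ℝ := hS.eigenvectorUnitary.1 with hOdef
  have hO : O ∈ orthogonalGroup n ℝ := hS.eigenvectorUnitary.2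
  have hspec : S = O * diagonal hS.eigenvalues * Oᵀ := by
    have := hS.spectral_theorem
    rw [Unitary.conjStarAlgAut_apply] at this
    exact this
  set Q := complexify O with hQdef
  have hQ1 : Qᵀ * Q = 1 := complexify_transpose_mul_self hO
  have hQ2 : Q * Qᵀ = 1 := complexify_mul_transpose_self hO
  have hHspec : H = Q * diagonal (fun i => (hS.eigenvalues i : ℂ)) * Qᵀ := by
    have := congrArg complexify hspec
    rwa [map_mul, map_mul, complexify_diagonal, complexify_transpose, hSH] at this
  -- The transform rearranged as `(H + i) P = c (i - H)`, so that a basis diagonalizing `H`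
  -- diagonalizes `P`.
  have hrel : H * P + Complex.I • P = (Complex.I * c) • (1 : Matrix n n ℂ) - c • H := by
    rw [hN, hM, mul_add, mul_smul_comm, mul_one, smul_sub, smul_smul] at hHN
    rw [eq_sub_iff_add_eq, add_right_comm, add_comm (H * P), hHN, sub_add_cancel]
  set E := Qᵀ * P * Q with hE
  have hPE : P = Q * E * Qᵀ := by
    rw [hE]
    calc P = (Q * Qᵀ) * P * (Q * Qᵀ) := by rw [hQ2, one_mul, mul_one]
      _ = _ := by simp only [mul_assoc]
  have hHE : Qᵀ * H * Q = diagonal (fun i => (hS.eigenvalues i : ℂ)) := by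
    rw [hHspec]
    calc _ = (Qᵀ * Q) * diagonal (fun i => (hS.eigenvalues i : ℂ)) * (Qᵀ * Q) := by
          simp only [mul_assoc]
      _ = _ := by rw [hQ1, one_mul, mul_one]
  have hrelE : diagonal (fun i => (hS.eigenvalues i : ℂ)) * E + Complex.I • E =
      (Complex.I * c) • (1 : Matrix n n ℂ) -
        c • diagonal (fun i => (hS.eigenvalues i : ℂ)) := by
    have h1 := congrArg (fun A => Qᵀ * A * Q) hrel
    simp only [mul_add, add_mul, mul_sub, sub_mul, mul_smul_comm, smul_mul_assoc, mul_one, hQ1,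
      hHE] at h1
    rw [← h1, ← hE, ← hHE]
    congr 1
    calc _ = Qᵀ * H * (Q * Qᵀ) * P * Q := by simp only [hE, mul_assoc]
      _ = _ := by rw [hQ2, mul_one]; simp only [mul_assoc]
  refine ⟨O, hO, fun i => E i i, ?_⟩
  have hdiag : diagonal (fun i => E i i) = E := by
    ext i j
    by_cases h : i = j
    · subst h; simp
    · rw [diagonal_apply_ne _ h]
      have h1 := congrFun (congrFun hrelE i) j
      simp only [Matrix.add_apply, diagonal_mul, Matrix.smul_apply, Matrix.sub_apply, one_apply_ne h,
        diagonal_apply_ne _ h, smul_eq_mul, mul_zero, sub_zero, ← add_mul] at h1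
      -- Off the diagonal, `(λ i + I) * E i j = 0`; since `λ i` is real, the first factor has
      -- imaginary part 1.
      rcases mul_eq_zero.1 h1 with h2 | h2
      · have := congrArg Complex.im h2
        simp at this
      · exact h2.symm
  rw [hdiag]
  exact hPE

/-- Every unitary matrix is a product of a real orthogonal, a diagonal unitary and a real
orthogonal matrix. -/
theorem exists_orthogonal_mul_diagonal_mul_orthogonal {U : Matrix n n ℂ} (hU : Uᴴ * U = 1) :
    ∃ O₁ ∈ orthogonalGroup n ℝ, ∃ O₂ ∈ orthogonalGroup n ℝ, ∃ θ : n → ℝ,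
      U = complexify O₁ * diagonal (fun i => Complex.exp (Complex.I * θ i)) *
        (complexify O₂)ᵀ := by
  have hU' : U * Uᴴ = 1 := mul_eq_one_comm.1 hU
  have hP : (Uᵀ * U)ᴴ * (Uᵀ * U) = 1 := by
    have h1 : Uᵀᴴ * Uᵀ = 1 := by
      have := congrArg transpose hU'
      rwa [transpose_mul, transpose_one] at this
    rw [conjTranspose_mul]
    calc _ = Uᴴ * (Uᵀᴴ * Uᵀ) * U := by simp only [mul_assoc]
      _ = 1 := by rw [h1, mul_one, hU]
  obtain ⟨O, hO, e, he⟩ := exists_orthogonal_diagonalization hP (by simp [IsSymm])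
  set Q := complexify O with hQdef
  have hQ1 : Qᵀ * Q = 1 := complexify_transpose_mul_self hO
  have hQ2 : Q * Qᵀ = 1 := complexify_mul_transpose_self hO
  have hQH : Qᴴ = Qᵀ := conjTranspose_complexify O
  have hE : Qᵀ * (Uᵀ * U) * Q = diagonal e := by
    rw [he]
    calc _ = (Qᵀ * Q) * diagonal e * (Qᵀ * Q) := by simp only [mul_assoc]
      _ = _ := by rw [hQ1, one_mul, mul_one]
  have hnorm : ∀ i, ‖e i‖ = 1 := by
    intro i
    have h1 : (diagonal e)ᴴ * diagonal e = 1 := by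
      rw [← hE]
      simp only [conjTranspose_mul, hQH]
      have hQtH : Qᵀᴴ = Q := by rw [← hQH, conjTranspose_conjTranspose]
      rw [hQtH]
      calc _ = Qᵀ * ((Uᵀ * U)ᴴ * ((Q * Qᵀ) * (Uᵀ * U))) * Q := by
            simp only [mul_assoc, conjTranspose_mul]
        _ = 1 := by rw [hQ2, one_mul, hP, mul_one, hQ1]
    have h2 := congrFun (congrFun h1 i) i
    rw [diagonal_conjTranspose, diagonal_mul_diagonal, diagonal_apply_eq, one_apply_eq] at h2
    have h3 : ((‖e i‖ : ℂ)) ^ 2 = 1 := by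
      rw [← Complex.conj_mul']; exact h2
    have h4 : ‖e i‖ ^ 2 = 1 := by exact_mod_cast h3
    nlinarith [norm_nonneg (e i)]
  set θ : n → ℝ := fun i => Complex.arg (e i) / 2 with hθ
  have hsq : ∀ i, Complex.exp (Complex.I * θ i) * Complex.exp (Complex.I * θ i) = e i := by
    intro i
    rw [← Complex.exp_add]
    have := Complex.norm_mul_exp_arg_mul_I (e i)
    rw [hnorm, Complex.ofReal_one, one_mul] at this
    rw [← this, hθ]
    congr 1
    push_cast
    ring
  set D : Matrix n n ℂ := diagonal (fun i => Complex.exp (Complex.I * θ i)) with hD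
  set D' : Matrix n n ℂ := diagonal (fun i => Complex.exp (-(Complex.I * θ i))) with hD'
  have hDD' : D' * D = 1 := by
    rw [hD, hD', diagonal_mul_diagonal, ← diagonal_one]
    congr 1
    ext i
    rw [← Complex.exp_add]
    simp
  have hDD : D * D = diagonal e := by
    rw [hD, diagonal_mul_diagonal]
    exact congrArg _ (funext hsq)
  have hDH : D'ᴴ = D := by
    rw [hD, hD', diagonal_conjTranspose]
    congr 1
    ext i
    simp [← Complex.exp_conj]
  have hDt : D'ᵀ = D' := diagonal_transpose _
  have hD'D : D * D' = 1 := mul_eq_one_comm.1 hDD'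
  -- `VᵀV = D' (Qᵀ Uᵀ U Q) D' = D' D² D' = 1`.
  obtain ⟨O₁, hO₁, h⟩ := exists_orthogonal_of_unitary (V := U * Q * D')
    (by
      simp only [conjTranspose_mul, hQH, hDH]
      calc _ = D * (Qᵀ * ((Uᴴ * U) * Q)) * D' := by simp only [mul_assoc]
        _ = 1 := by rw [hU, one_mul, hQ1, mul_one, hD'D])
    (by
      simp only [transpose_mul, hDt]
      calc _ = D' * (Qᵀ * (Uᵀ * U) * Q) * D' := by simp only [mul_assoc]
        _ = (D' * D) * (D * D') := by rw [hE, ← hDD]; simp only [mul_assoc]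
        _ = 1 := by rw [hDD', hD'D, one_mul])
  refine ⟨O₁, hO₁, O, hO, θ, ?_⟩
  rw [h]
  calc U = U * (Q * Qᵀ) := by rw [hQ2, mul_one]
    _ = U * Q * (D' * D) * Qᵀ := by rw [hDD', mul_one]; simp only [mul_assoc]
    _ = _ := by simp only [mul_assoc, hQdef, hD]

end Diagonalization

/-! ### Quaternions and the isometries of ℝ⁴ -/

/-- The quaternion `x₀ + x₁ i + x₂ j + x₃ k` as a complex `2 × 2` matrix. -/
def quat (x : EuclideanSpace ℝ (Fin 4)) : Matrix (Fin 2) (Fin 2) ℂ :=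
  !![x 0 + x 1 * Complex.I, x 2 + x 3 * Complex.I; -x 2 + x 3 * Complex.I, x 0 - x 1 * Complex.I]

theorem quat_conjTranspose (x : EuclideanSpace ℝ (Fin 4)) :
    (quat x)ᴴ = !![x 0 - x 1 * Complex.I, -x 2 - x 3 * Complex.I;
      x 2 - x 3 * Complex.I, x 0 + x 1 * Complex.I] := by
  ext i j
  fin_cases i <;> fin_cases j <;> simp [quat] <;> ring

theorem quat_neg (x : EuclideanSpace ℝ (Fin 4)) : quat (-x) = -quat x := by
  ext i j
  fin_cases i <;> fin_cases j <;> simp [quat] <;> ring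

theorem quat_sub (x y : EuclideanSpace ℝ (Fin 4)) : quat (x - y) = quat x - quat y := by
  ext i j
  fin_cases i <;> fin_cases j <;> simp [quat] <;> ring

theorem quat_smul (r : ℝ) (x : EuclideanSpace ℝ (Fin 4)) : quat (r • x) = (r : ℂ) • quat x := by
  ext i j
  fin_cases i <;> fin_cases j <;> simp [quat] <;> ring

theorem quat_mul_conjTranspose_add (x u : EuclideanSpace ℝ (Fin 4)) :
    quat u * (quat x)ᴴ + quat x * (quat u)ᴴ = ((2 * inner ℝ u x : ℝ) : ℂ) • 1 := by
  rw [quat_conjTranspose, quat_conjTranspose, PiLp.inner_apply, Fin.sum_univ_four]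
  ext i j
  fin_cases i <;> fin_cases j <;> simp [quat] <;>
    ring_nf <;> simp <;> ring

theorem quat_mul_conjTranspose_self (u : EuclideanSpace ℝ (Fin 4)) :
    quat u * (quat u)ᴴ = ((‖u‖ ^ 2 : ℝ) : ℂ) • 1 := by
  have h := quat_mul_conjTranspose_add u u
  rw [real_inner_self_eq_norm_sq, ← two_smul ℂ, Complex.ofReal_mul, Complex.ofReal_ofNat, mul_smul]
    at h
  exact smul_right_injective _ (two_ne_zero' ℂ) h

theorem quat_mem_specialUnitaryGroup {u : EuclideanSpace ℝ (Fin 4)} (hu : ‖u‖ = 1) :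
    quat u ∈ specialUnitaryGroup (Fin 2) ℂ := by
  rw [mem_specialUnitaryGroup_iff, mem_unitaryGroup_iff]
  have h : quat u * (quat u)ᴴ = 1 := by rw [quat_mul_conjTranspose_self, hu]; simp
  refine ⟨h, ?_⟩
  have h1 := congrFun (congrFun h 0) 0
  rw [quat_conjTranspose] at h1
  simp [quat, mul_apply, Fin.sum_univ_two] at h1
  rw [det_fin_two]
  simp only [quat, of_apply, cons_val', cons_val_zero, cons_val_one, cons_val_fin_one]
  linear_combination h1

theorem specialUnitaryGroup_conjTranspose_mem {n : Type*} [Fintype n] [DecidableEq n]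
    {A : Matrix n n ℂ} (hA : A ∈ specialUnitaryGroup n ℂ) : Aᴴ ∈ specialUnitaryGroup n ℂ :=
  (star (⟨A, hA⟩ : specialUnitaryGroup n ℂ)).2

theorem specialUnitaryGroup_transpose_mem {n : Type*} [Fintype n] [DecidableEq n]
    {A : Matrix n n ℂ} (hA : A ∈ specialUnitaryGroup n ℂ) : Aᵀ ∈ specialUnitaryGroup n ℂ := by
  rw [mem_specialUnitaryGroup_iff, mem_unitaryGroup_iff'] at hA
  rw [mem_specialUnitaryGroup_iff, mem_unitaryGroup_iff, det_transpose]
  refine ⟨?_, hA.2⟩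
  have := congrArg transpose hA.1
  rw [transpose_mul, transpose_one] at this
  exact this

theorem conjTranspose_mul_self_of_mem_specialUnitaryGroup {n : Type*} [Fintype n] [DecidableEq n]
    {A : Matrix n n ℂ} (hA : A ∈ specialUnitaryGroup n ℂ) : Aᴴ * A = 1 :=
  mem_unitaryGroup_iff'.1 (mem_specialUnitaryGroup_iff.1 hA).1

theorem mul_conjTranspose_self_of_mem_specialUnitaryGroup {n : Type*} [Fintype n] [DecidableEq n]
    {A : Matrix n n ℂ} (hA : A ∈ specialUnitaryGroup n ℂ) : A * Aᴴ = 1 :=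
  mem_unitaryGroup_iff.1 (mem_specialUnitaryGroup_iff.1 hA).1

/-- Multiplying `u x̄ + x ū = 2⟨u, x⟩` on the right by `u` gives `u x̄ u + x = 2⟨u, x⟩ u`. -/
theorem quat_reflection {u : EuclideanSpace ℝ (Fin 4)} (hu : ‖u‖ = 1)
    (x : EuclideanSpace ℝ (Fin 4)) :
    quat ((ℝ ∙ u)ᗮ.reflection x) = -(quat u * (quat x)ᴴ * quat u) := by
  have h1 : quat u * (quat x)ᴴ * quat u + quat x = ((2 * inner ℝ u x : ℝ) : ℂ) • quat u := by
    have h := congrArg (· * quat u) (quat_mul_conjTranspose_add x u)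
    simp only [add_mul, smul_mul_assoc, one_mul] at h
    rwa [mul_assoc (quat x), conjTranspose_mul_self_of_mem_specialUnitaryGroup
      (quat_mem_specialUnitaryGroup hu), mul_one] at h
  have h2 : (ℝ ∙ u)ᗮ.reflection x = x - (2 * inner ℝ u x) • u := by
    rw [Submodule.reflection_orthogonal_apply, Submodule.reflection_singleton_apply, hu]
    simp [mul_smul, two_smul]
  rw [h2, quat_sub, quat_smul, ← h1]
  abel

/-- Every linear isometry of the quaternions is `x ↦ a x b` or `x ↦ a x̄ b` with unit quaternions
`a` and `b`. -/
theorem exists_quat_isometry (φ : EuclideanSpace ℝ (Fin 4) ≃ₗᵢ[ℝ] EuclideanSpace ℝ (Fin 4)) :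
    ∃ A ∈ specialUnitaryGroup (Fin 2) ℂ, ∃ B ∈ specialUnitaryGroup (Fin 2) ℂ,
      (∀ x, quat (φ x) = A * quat x * B) ∨ (∀ x, quat (φ x) = A * (quat x)ᴴ * B) := by
  have hφ : φ ∈ Subgroup.closure (Set.range fun v : EuclideanSpace ℝ (Fin 4) =>
      (ℝ ∙ v)ᗮ.reflection) := by
    rw [LinearIsometryEquiv.reflections_generate]; trivial
  induction hφ using Subgroup.closure_induction with
  | one => exact ⟨1, one_mem _, 1, one_mem _, Or.inl fun x => by simp⟩
  | mem φ h =>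
    obtain ⟨v, rfl⟩ := h
    -- The generating family includes `v = 0`, whose reflection is the identity.
    by_cases hv : v = 0
    · subst hv
      exact ⟨1, one_mem _, 1, one_mem _, Or.inl fun x => by
        rw [Submodule.reflection_mem_subspace_eq_self (by simp), one_mul, mul_one]⟩
    · have hu : ‖‖v‖⁻¹ • v‖ = 1 := by
        rw [norm_smul, norm_inv, norm_norm, inv_mul_cancel₀ (norm_ne_zero_iff.2 hv)]
      have hspan : (ℝ ∙ (‖v‖⁻¹ • v)) = ℝ ∙ v :=
        Submodule.span_singleton_smul_eq (isUnit_iff_ne_zero.2 (by simpa using hv)) v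
      refine ⟨quat (-(‖v‖⁻¹ • v)), quat_mem_specialUnitaryGroup (by rwa [norm_neg]),
        quat (‖v‖⁻¹ • v), quat_mem_specialUnitaryGroup hu, Or.inr fun x => ?_⟩
      have := quat_reflection hu x
      rw [quat_neg, neg_mul, neg_mul, ← this]
      simp only [hspan]
  | mul φ ψ _ _ ihφ ihψ =>
    obtain ⟨A, hA, B, hB, h⟩ := ihφ
    obtain ⟨A', hA', B', hB', h'⟩ := ihψ
    have hAH := specialUnitaryGroup_conjTranspose_mem hA'
    have hBH := specialUnitaryGroup_conjTranspose_mem hB'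
    rcases h with h | h <;> rcases h' with h' | h'
    · exact ⟨A * A', mul_mem hA hA', B' * B, mul_mem hB' hB, Or.inl fun x => by
        rw [LinearIsometryEquiv.coe_mul, Function.comp_apply, h, h']; simp only [mul_assoc]⟩
    · exact ⟨A * A', mul_mem hA hA', B' * B, mul_mem hB' hB, Or.inr fun x => by
        rw [LinearIsometryEquiv.coe_mul, Function.comp_apply, h, h']; simp only [mul_assoc]⟩
    -- Conjugation reverses products, so the inner factors swap sides.
    · exact ⟨A * B'ᴴ, mul_mem hA hBH, A'ᴴ * B, mul_mem hAH hB, Or.inr fun x => by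
        rw [LinearIsometryEquiv.coe_mul, Function.comp_apply, h, h']; simp only [conjTranspose_mul, mul_assoc]⟩
    · exact ⟨A * B'ᴴ, mul_mem hA hBH, A'ᴴ * B, mul_mem hAH hB, Or.inl fun x => by
        rw [LinearIsometryEquiv.coe_mul, Function.comp_apply, h, h']
        simp only [conjTranspose_mul, conjTranspose_conjTranspose, mul_assoc]⟩
  | inv φ _ ih =>
    obtain ⟨A, hA, B, hB, h⟩ := ih
    have hAH := specialUnitaryGroup_conjTranspose_mem hA
    have hBH := specialUnitaryGroup_conjTranspose_mem hB
    have hA1 := conjTranspose_mul_self_of_mem_specialUnitaryGroup hA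
    have hB1 := mul_conjTranspose_self_of_mem_specialUnitaryGroup hB
    have hφ : ∀ x, φ (φ⁻¹ x) = x := fun x => φ.apply_symm_apply x
    rcases h with h | h
    · refine ⟨Aᴴ, hAH, Bᴴ, hBH, Or.inl fun x => ?_⟩
      have h1 := h (φ⁻¹ x)
      rw [hφ] at h1
      rw [h1]
      calc _ = (Aᴴ * A) * quat (φ⁻¹ x) * (B * Bᴴ) := by rw [hA1, hB1, one_mul, mul_one]
        _ = _ := by simp only [mul_assoc]
    -- Solving `y = A x̄ B` gives `x̄ = Aᴴ y Bᴴ`, so `x = B ȳ A`.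
    · refine ⟨B, hB, A, hA, Or.inr fun x => ?_⟩
      have h1 := h (φ⁻¹ x)
      rw [hφ] at h1
      rw [h1]
      simp only [conjTranspose_mul, conjTranspose_conjTranspose]
      calc _ = (B * Bᴴ) * quat (φ⁻¹ x) * (Aᴴ * A) := by rw [hA1, hB1, one_mul, mul_one]
        _ = _ := by simp only [mul_assoc]

/-! ### The magic basis, local gates and the interaction term -/

/-- The columns of `magic` are the (unnormalized) vectors of the magic basis. -/
def magic : Matrix (Fin 4) (Fin 4) ℂ :=
  !![1, Complex.I, 0, 0; 0, 0, 1, Complex.I; 0, 0, -1, Complex.I; 1, -Complex.I, 0, 0]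

/-- Quaternion conjugation in coordinates. -/
def quatConj : Matrix (Fin 4) (Fin 4) ℂ := diagonal ![1, -1, -1, -1]

theorem magic_conjTranspose : magicᴴ =
    !![1, 0, 0, 1; -Complex.I, 0, 0, Complex.I; 0, 1, -1, 0; 0, -Complex.I, -Complex.I, 0] := by
  ext i j
  fin_cases i <;> fin_cases j <;> simp [magic]

theorem magic_mul_conjTranspose : magic * magicᴴ = (2 : ℂ) • 1 := by
  rw [magic_conjTranspose]
  ext i j
  fin_cases i <;> fin_cases j <;> simp [magic, mul_apply, Fin.sum_univ_four] <;> norm_num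

theorem tensor_eq (A B : Matrix (Fin 2) (Fin 2) ℂ) : tensor A B =
    !![A 0 0 * B 0 0, A 0 0 * B 0 1, A 0 1 * B 0 0, A 0 1 * B 0 1;
       A 0 0 * B 1 0, A 0 0 * B 1 1, A 0 1 * B 1 0, A 0 1 * B 1 1;
       A 1 0 * B 0 0, A 1 0 * B 0 1, A 1 1 * B 0 0, A 1 1 * B 0 1;
       A 1 0 * B 1 0, A 1 0 * B 1 1, A 1 1 * B 1 0, A 1 1 * B 1 1] := by
  ext i j
  fin_cases i <;> fin_cases j <;> rfl

theorem tensor_mul_tensor (A B C D : Matrix (Fin 2) (Fin 2) ℂ) :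
    tensor A B * tensor C D = tensor (A * C) (B * D) := by
  rw [tensor, tensor, tensor, mul_kronecker_mul, reindex_apply, reindex_apply, reindex_apply,
    submatrix_mul_equiv]

theorem tensor_one_one : tensor 1 1 = 1 := by
  simp [tensor]

/-- Row-major vectorization of a `2 × 2` matrix. -/
def vec4 (M : Matrix (Fin 2) (Fin 2) ℂ) : Fin 4 → ℂ := ![M 0 0, M 0 1, M 1 0, M 1 1]

theorem vec4_mul_mul (A M B : Matrix (Fin 2) (Fin 2) ℂ) :
    vec4 (A * M * B) = tensor A Bᵀ *ᵥ vec4 M := by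
  rw [tensor_eq]
  ext i
  fin_cases i <;>
    simp [vec4, mul_apply, Fin.sum_univ_two, Fin.sum_univ_four, mulVec, dotProduct] <;> ring

theorem vec4_quat (x : EuclideanSpace ℝ (Fin 4)) :
    vec4 (quat x) = magic *ᵥ fun i => (x i : ℂ) := by
  ext i
  fin_cases i <;>
    simp [vec4, quat, magic, Fin.sum_univ_four, mulVec, dotProduct] <;> ring

theorem vec4_quat_conjTranspose (x : EuclideanSpace ℝ (Fin 4)) :
    vec4 (quat x)ᴴ = magic *ᵥ quatConj *ᵥ fun i => (x i : ℂ) := by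
  rw [quat_conjTranspose]
  ext i
  fin_cases i <;>
    simp [vec4, magic, quatConj, Fin.sum_univ_four, mulVec, dotProduct, diagonal_apply] <;> ring

theorem eq_of_mulVec_ofReal_eq {M N : Matrix (Fin 4) (Fin 4) ℂ}
    (h : ∀ x : EuclideanSpace ℝ (Fin 4), (M *ᵥ fun i => (x i : ℂ)) = N *ᵥ fun i => (x i : ℂ)) :
    M = N := by
  refine ext_of_mulVec_single fun i => ?_
  have hi : (fun j => ((EuclideanSpace.single i (1 : ℝ) : EuclideanSpace ℝ (Fin 4)) j : ℂ)) =
      Pi.single i 1 := by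
    ext j
    by_cases hj : j = i
    · subst hj; simp
    · simp [hj]
  have := h (EuclideanSpace.single i 1)
  rwa [hi] at this

/-- In the magic basis, real orthogonal matrices are tensor products of elements of `SU(2)`,
up to quaternion conjugation. -/
theorem exists_magic_mul_complexify {O : Matrix (Fin 4) (Fin 4) ℝ}
    (hO : O ∈ orthogonalGroup (Fin 4) ℝ) :
    ∃ A ∈ specialUnitaryGroup (Fin 2) ℂ, ∃ B ∈ specialUnitaryGroup (Fin 2) ℂ,
      ∃ s : Fin 4 → ℝ, magic * complexify O =
        tensor A B * magic * diagonal (fun i => Complex.exp (Complex.I * s i)) := by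
  let φ := Unitary.linearIsometryEquiv
    (⟨toEuclideanCLM (n := Fin 4) (𝕜 := ℝ) O, Unitary.map_mem _ hO⟩ :
      unitary (EuclideanSpace ℝ (Fin 4) →L[ℝ] EuclideanSpace ℝ (Fin 4)))
  have hφ : ∀ x, (fun i => (φ x i : ℂ)) = complexify O *ᵥ fun i => (x i : ℂ) := by
    intro x
    ext i
    have : φ x i = (O *ᵥ x.ofLp) i := rfl
    rw [this]
    simp [mulVec, dotProduct, complexify_apply]
  obtain ⟨A, hA, B, hB, h⟩ := exists_quat_isometry φ
  refine ⟨A, hA, Bᵀ, specialUnitaryGroup_transpose_mem hB, ?_⟩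
  rcases h with h | h
  · refine ⟨0, eq_of_mulVec_ofReal_eq fun x => ?_⟩
    rw [← mulVec_mulVec, ← hφ, ← vec4_quat, h, vec4_mul_mul, vec4_quat]
    simp
  -- The signs of quaternion conjugation written as phases 0 and π.
  · have hJ : diagonal (fun i => Complex.exp (Complex.I *
        ((![0, Real.pi, Real.pi, Real.pi] : Fin 4 → ℝ) i : ℂ))) = quatConj := by
      rw [quatConj]
      congr 1
      ext i
      fin_cases i <;> simp [mul_comm Complex.I]
    refine ⟨![0, Real.pi, Real.pi, Real.pi], eq_of_mulVec_ofReal_eq fun x => ?_⟩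
    rw [hJ, ← mulVec_mulVec, ← hφ, ← vec4_quat, h, vec4_mul_mul, vec4_quat_conjTranspose,
      ← mulVec_mulVec, ← mulVec_mulVec]

theorem isUnit_magic : IsUnit magic := by
  refine IsUnit.of_mul_eq_one ((1 / 2 : ℂ) • magicᴴ) ?_
  rw [mul_smul_comm, magic_mul_conjTranspose, smul_smul]
  norm_num

theorem interaction_mul_magic (k₀ kx ky kz : ℂ) :
    (k₀ • (1 : Matrix (Fin 4) (Fin 4) ℂ) + kx • sigmaXX + ky • sigmaYY + kz • sigmaZZ) * magic =
      magic * diagonal ![k₀ + kx - ky + kz, k₀ - kx + ky + kz, k₀ - kx - ky - kz,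
        k₀ + kx + ky - kz] := by
  rw [sigmaXX, sigmaYY, sigmaZZ, tensor_eq, tensor_eq, tensor_eq]
  ext i j
  fin_cases i <;> fin_cases j <;>
    simp [magic, sigmaX, sigmaY, sigmaZ, mul_apply, Fin.sum_univ_four, one_apply] <;> ring

/-- The eigenvalues in `interaction_mul_magic` depend on the coefficients through a 4 × 4 Hadamard
sign matrix; its inverse, a quarter of its transpose, supplies the witnesses. -/
theorem magic_mul_diagonal_exp (θ : Fin 4 → ℝ) : ∃ k₀ kx ky kz : ℝ,
    magic * diagonal (fun i => Complex.exp (Complex.I * θ i)) * magic⁻¹ =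
      NormedSpace.exp (Complex.I • ((k₀ : ℂ) • (1 : Matrix (Fin 4) (Fin 4) ℂ) +
        (kx : ℂ) • sigmaXX + (ky : ℂ) • sigmaYY + (kz : ℂ) • sigmaZZ)) := by
  refine ⟨(θ 0 + θ 1 + θ 2 + θ 3) / 4, (θ 0 - θ 1 - θ 2 + θ 3) / 4,
    (-θ 0 + θ 1 - θ 2 + θ 3) / 4, (θ 0 + θ 1 - θ 2 - θ 3) / 4, ?_⟩
  have hdet := (isUnit_iff_isUnit_det _).1 isUnit_magic
  -- Inserting `magic * magic⁻¹` after the sum in the exponent exhibits it as a conjugate of a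
  -- diagonal matrix.
  rw [← mul_nonsing_inv_cancel_right _ (_ + _) hdet, interaction_mul_magic, ← smul_mul_assoc,
    ← mul_smul_comm, exp_conj _ _ isUnit_magic, ← diagonal_smul, exp_diagonal]
  congr 3
  ext i
  rw [Pi.coe_exp, ← Complex.exp_eq_exp_ℂ]
  congr 1
  fin_cases i <;> simp <;> ring

end KAK

/-! ### Assembly of the decomposition -/

theorem mainTheorem1 (X : Matrix (Fin 4) (Fin 4) ℂ)
    (hX : X ∈ Matrix.unitaryGroup (Fin 4) ℂ) :
    ∃ A₁ ∈ Matrix.specialUnitaryGroup (Fin 2) ℂ, ∃ A₀ ∈ Matrix.specialUnitaryGroup (Fin 2) ℂ,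
    ∃ B₁ ∈ Matrix.specialUnitaryGroup (Fin 2) ℂ, ∃ B₀ ∈ Matrix.specialUnitaryGroup (Fin 2) ℂ,
    ∃ k₀ kx ky kz : ℝ,
      X = KAK.tensor A₁ A₀ *
          NormedSpace.exp (Complex.I • ((k₀ : ℂ) • (1 : Matrix (Fin 4) (Fin 4) ℂ) +
            (kx : ℂ) • KAK.sigmaXX + (ky : ℂ) • KAK.sigmaYY + (kz : ℂ) • KAK.sigmaZZ)) *
          KAK.tensor B₁ B₀ := by
  open Matrix KAK in
  have hXX : Xᴴ * X = 1 := Matrix.mem_unitaryGroup_iff'.1 hX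
  have hdet := (isUnit_iff_isUnit_det _).1 isUnit_magic
  have hinv : magic⁻¹ = (1 / 2 : ℂ) • magicᴴ := by
    refine inv_eq_right_inv ?_
    rw [mul_smul_comm, magic_mul_conjTranspose, smul_smul]
    norm_num
  -- `magic` is √2 times a unitary; the factors 1/2 and 2 cancel, so conjugating by it preserves
  -- unitarity.
  have hW : magic⁻¹ᴴ * magic⁻¹ = (1 / 2 : ℂ) • (1 : Matrix (Fin 4) (Fin 4) ℂ) := by
    rw [hinv, conjTranspose_smul, conjTranspose_conjTranspose, smul_mul_assoc, mul_smul_comm,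
      magic_mul_conjTranspose, smul_smul, smul_smul]
    norm_num
  have hW' : magicᴴ * magic = (2 : ℂ) • (1 : Matrix (Fin 4) (Fin 4) ℂ) := by
    have h1 : magicᴴ = (2 : ℂ) • magic⁻¹ := by rw [hinv, smul_smul]; norm_num
    rw [h1, smul_mul_assoc, nonsing_inv_mul _ hdet]
  obtain ⟨O₁, hO₁, O₂, hO₂, θ, hU⟩ :=
    exists_orthogonal_mul_diagonal_mul_orthogonal (U := magic⁻¹ * X * magic) (by
      calc _ = magicᴴ * (Xᴴ * ((magic⁻¹ᴴ * magic⁻¹) * X)) * magic := by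
            simp only [conjTranspose_mul, mul_assoc]
        _ = 1 := by
            rw [hW, smul_mul_assoc, one_mul, mul_smul_comm, hXX, mul_smul_comm, mul_one,
              smul_mul_assoc, hW', smul_smul]
            norm_num)
  obtain ⟨A₁, hA₁, A₀, hA₀, s, hA⟩ := exists_magic_mul_complexify hO₁
  obtain ⟨C₁, hC₁, C₀, hC₀, t, hC⟩ := exists_magic_mul_complexify hO₂
  -- The phases `s` and `t` left over from `O₁` and `O₂` merge with `θ`; `t` is subtracted because
  -- `O₂` enters inverted.
  obtain ⟨k₀, kx, ky, kz, hk⟩ := magic_mul_diagonal_exp fun i => s i + θ i - t i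
  refine ⟨A₁, hA₁, A₀, hA₀, C₁ᴴ, specialUnitaryGroup_conjTranspose_mem hC₁, C₀ᴴ,
    specialUnitaryGroup_conjTranspose_mem hC₀, k₀, kx, ky, kz, ?_⟩
  rw [← hk]
  set T := tensor C₁ C₀ with hT
  set T' := tensor C₁ᴴ C₀ᴴ with hT'
  have hTT : T' * T = 1 := by
    rw [hT, hT', tensor_mul_tensor, conjTranspose_mul_self_of_mem_specialUnitaryGroup hC₁,
      conjTranspose_mul_self_of_mem_specialUnitaryGroup hC₀, tensor_one_one]
  set Dt : Matrix (Fin 4) (Fin 4) ℂ := diagonal (fun i => Complex.exp (Complex.I * t i)) with hDt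
  set Dt' : Matrix (Fin 4) (Fin 4) ℂ :=
    diagonal (fun i => Complex.exp (-(Complex.I * t i))) with hDt'
  have hDD : Dt' * Dt = 1 := by
    rw [hDt, hDt', diagonal_mul_diagonal, ← diagonal_one]
    congr 1
    ext i
    rw [← Complex.exp_add]
    simp
  -- Both sides are inverses of `magic * complexify O₂ = T * magic * Dt`.
  have hright : (complexify O₂)ᵀ * magic⁻¹ = Dt' * magic⁻¹ * T' := by
    have hQ := complexify_transpose_mul_self hO₂
    have h1 : (complexify O₂)ᵀ * magic⁻¹ * (magic * complexify O₂) = 1 := by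
      rw [← mul_assoc, nonsing_inv_mul_cancel_right _ _ hdet, hQ]
    have h2 : Dt' * magic⁻¹ * T' * (magic * complexify O₂) = 1 := by
      rw [hC]
      calc _ = Dt' * (magic⁻¹ * ((T' * T) * magic)) * Dt := by simp only [mul_assoc]
        _ = 1 := by rw [hTT, one_mul, nonsing_inv_mul _ hdet, mul_one, hDD]
    have h3 := mul_eq_one_comm.1 h1
    calc _ = (Dt' * magic⁻¹ * T' * (magic * complexify O₂)) * ((complexify O₂)ᵀ * magic⁻¹) := by
          rw [h2, one_mul]
      _ = _ := by rw [mul_assoc, h3, mul_one]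
  calc X = magic * (magic⁻¹ * X * magic) * magic⁻¹ := by
        rw [mul_assoc magic⁻¹, mul_nonsing_inv_cancel_left _ _ hdet,
          mul_nonsing_inv_cancel_right _ _ hdet]
    _ = (magic * complexify O₁) * diagonal (fun i => Complex.exp (Complex.I * θ i)) *
          ((complexify O₂)ᵀ * magic⁻¹) := by rw [hU]; simp only [mul_assoc]
    _ = tensor A₁ A₀ * (magic * (diagonal (fun i => Complex.exp (Complex.I * s i)) *
          diagonal (fun i => Complex.exp (Complex.I * θ i)) * Dt') * magic⁻¹) * T' := by
        rw [hA, hright]; simp only [mul_assoc]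
    _ = _ := by
        rw [diagonal_mul_diagonal, hDt', diagonal_mul_diagonal]
        congr 5
        funext i
        rw [← Complex.exp_add, ← Complex.exp_add]
        push_cast
        ring_nf
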